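/- Let $m\ge 2$ be an integer, $\alpha>0$ and $\delta>-1$. Consider the inverse power law de-preferential attachment model with $m$ edges per vertex: $G_1$ is a single vertex $v_1$ carrying $m$ free half-edges (so $d_1(1)=m$), and for each $n\ge 1$, $G_{n+1}$ is obtained from $G_n$ by adding a vertex $v_{n+1}$ with $m$ half-edges $e_{n+1,1},\dots,e_{n+1,m}$, which are attached one after another to vertices of $\{v_1,\dots,v_n\}$ (multiple edges may occur). Write $d_j(n+1,k)$ for the degree of $v_j$, $1\le j\le n$, after $k$ of these half-edges have been attached, $0\le k\le m-1$, and $d_j(n)=d_j(n+1,0)$ for its degree in $G_n$; all half-edges at a vertex, free or attached, count towards its degree. Given the sigma-algebra $\mathcal F_{n+1,k}$ generated by all attachments made so far, the next half-edge is attached to $v_j$ with conditional probability $$P\bigl(e_{n+1,k+1}=\{v_{n+1},v_j\}\mid\mathcal F_{n+1,k}\bigr)=\frac{(\delta+d_j(n+1,k))^{-\alpha}}{\sum_{l=1}^{n}(\delta+d_l(n+1,k))^{-\alpha}},\qquad 1\le j\le n.$$ Then there are constants $0<c<C$, depending only on $m,\alpha,\delta$, such that for every fixed $i\ge 1$, $$P\left(c\le\frac{d_i(n)}{m\,(\log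 n)^{1/(1+\alpha)}}\le C\right)\longrightarrow 1\qquad(n\to\infty).$$ (For $\alpha=1$ the normalization is $m\sqrt{\log n}$.) -/

import Mathlib

open MeasureTheory Filter Topology

namespace DePref

/-- Labels of the half-edges present once the graph on `v_1, …, v_n` is complete and the first `k`
half-edges of the incoming vertex `v_{n+1}` have been attached.  The pair `(l, r)` with
`1 ≤ l` and `r < m` stands for the `(r+1)`-st half-edge brought by the vertex `v_l`. -/
def halfEdges (m n k : ℕ) : Finset (ℕ × ℕ) :=
  Finset.Icc 1 n ×ˢ Finset.range m ∪ {n + 1} ×ˢ Finset.range k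

/-- Labels of the half-edges among `halfEdges m n k` that have been joined to an older vertex.
The first vertex `v_1` finds no older vertex, so its `m` half-edges stay free. -/
def attached (m n k : ℕ) : Finset (ℕ × ℕ) :=
  (halfEdges m n k).filter fun p => 2 ≤ p.1

/-- `degree m e i n k` is `d_i(n+1, k)`, the degree of `v_i` after `k` half-edges of `v_{n+1}` are
attached, where `e l r` is the index of the vertex to which the half-edge `(l, r)`, `l ≥ 2`, is
joined: half-edges brought by `v_i` plus half-edges of younger vertices joined to `v_i`. -/
def degree (m : ℕ) (e : ℕ → ℕ → ℕ) (i n k : ℕ) : ℕ :=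
  ((halfEdges m n k).filter fun p => p.1 = i).card +
    ((attached m n k).filter fun p => e p.1 p.2 = i).card

/-- The sigma-algebra `F_{n+1,k}` of the natural filtration: generated by the end points of all
edges attached before the `(k+1)`-st half-edge of `v_{n+1}`. -/
abbrev history {Ω : Type*} (m : ℕ) (e : ℕ → ℕ → Ω → ℕ) (n k : ℕ) : MeasurableSpace Ω :=
  ⨆ p ∈ attached m n k, MeasurableSpace.comap (e p.1 p.2) ⊤

/-- The attachment weight `(δ + d_i(n+1,k))^(-α)`. -/
noncomputable def weight (m : ℕ) (α δ : ℝ) (e : ℕ → ℕ → ℕ) (i n k : ℕ) : ℝ :=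
  1 / (δ + (degree m e i n k : ℝ)) ^ α

/-- The random end points `e l r` (`l ≥ 2`, `r < m`) form the inverse power law de-preferential
attachment model with `m` edges per vertex, exponent `α` and shift `δ`, started from the single
vertex `v_1` carrying `m` free half-edges: given the past, the next half-edge of `v_{n+1}` is
joined to `v_i`, `1 ≤ i ≤ n`, with probability proportional to `(δ + d_i(n+1,k))^(-α)`. -/
structure IsInverseDePreferential {Ω : Type*} [MeasurableSpace Ω] (m : ℕ) (α δ : ℝ)
    (P : Measure Ω) (e : ℕ → ℕ → Ω → ℕ) : Prop where
  measurable_endpoint : ∀ l r, 2 ≤ l → r < m → Measurable (e l r)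
  attachment : ∀ n k i, 1 ≤ n → k < m → 1 ≤ i → i ≤ n →
    P[({ω | e (n + 1) k ω = i}).indicator (fun _ => (1 : ℝ)) | history m e n k] =ᵐ[P]
      fun ω => weight m α δ (fun l r => e l r ω) i n k /
        ∑ j ∈ Finset.Icc 1 n, weight m α δ (fun l r => e l r ω) j n k

end DePref

/-! The degrees in play sum to at most `3 * m * n`, so at least about half of the vertices have
degree at most `6 * m`, and the total attachment weight is of exact order `n`. Hence at the `t`-th
half-edge `v_i` is hit with conditional probability of order `(δ + d) ^ (-α) / t`, whatever the
other degrees are. A hit raises `Y = (δ + d) ^ (1 + α)` by about `(δ + d) ^ α`, which cancels the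
weight: the drift of `Y` lies between two constants times `1 / t`, and its compensator is of order
`S = ∑ 1 / t`, that is `log n` (`drift_bounds`, `compensator_bounds`). The martingale part has
second moment of order at most `S ^ (2 - 1 / (1 + α))`, hence `o(S ^ 2)`
(`tendsto_integral_sq_div`), and Chebyshev's inequality confines `Y` to constant multiples of `log
n` (`tendsto_measure`). The index `i` only influences how large `n` must be, so the constants do not
depend on it. -/

namespace DePref

/-! ### Elementary power inequalities. -/

section Growth

/-- The increment `(y + 1)^(1+α) - y^(1+α)`. -/
noncomputable def powIncrement (α y : ℝ) : ℝ := (y + 1) ^ (1 + α) - y ^ (1 + α)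

/-- The upper bound is the mean value theorem together with `y + 1 ≤ 2 * y`, which needs `1 ≤ y`. -/
lemma powIncrement_bounds {α y : ℝ} (hα : 0 < α) (hy : 1 ≤ y) :
    y ^ α ≤ powIncrement α y ∧ powIncrement α y ≤ (1 + α) * 2 ^ α * y ^ α := by
  have hy0 : 0 < y := by linarith
  constructor
  · have h1 : y ^ α ≤ (y + 1) ^ α := Real.rpow_le_rpow hy0.le (by linarith) hα.le
    unfold powIncrement
    rw [Real.rpow_add (by linarith), Real.rpow_add hy0, Real.rpow_one, Real.rpow_one]
    nlinarith
  · have hder : ∀ x ∈ Set.Ioo y (y + 1),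
        HasDerivAt (fun x : ℝ => x ^ (1 + α)) ((1 + α) * x ^ (1 + α - 1)) x := fun x hx =>
      Real.hasDerivAt_rpow_const (Or.inl (by linarith [hx.1]))
    obtain ⟨x, hx, he⟩ := exists_hasDerivAt_eq_slope (fun x : ℝ => x ^ (1 + α)) _
      (by linarith : y < y + 1)
      (Real.continuous_rpow_const (by linarith) |>.continuousOn) hder
    have h2 : powIncrement α y = (1 + α) * x ^ α := by
      have : (1 + α - 1) = α := by ring
      rw [this] at he
      rw [he, powIncrement]
      simp
    have h3 : x ^ α ≤ (2 * y) ^ α :=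
      Real.rpow_le_rpow (by linarith [hx.1]) (by linarith [hx.2]) hα.le
    rw [Real.mul_rpow (by norm_num) hy0.le] at h3
    rw [h2, mul_assoc]
    exact mul_le_mul_of_nonneg_left h3 (by linarith)

/-- Serves to bound the mean of `y ^ α` by that of `y ^ (1 + α)`, which the drift controls; `K`
stays free so that the two terms can be balanced later. -/
lemma rpow_le_div_add {α y K : ℝ} (hα : 0 < α) (hy : 1 ≤ y) (hK : 0 < K) :
    y ^ α ≤ y ^ (1 + α) / K + K ^ α := by
  have hy0 : 0 < y := by linarith
  rcases le_total y K with h | h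
  · have := Real.rpow_le_rpow hy0.le h hα.le
    have : 0 ≤ y ^ (1 + α) / K := by positivity
    linarith
  · have : y ^ α ≤ y ^ (1 + α) / K := by
      rw [le_div_iff₀ hK, Real.rpow_add hy0, Real.rpow_one, mul_comm]
      exact mul_le_mul_of_nonneg_right h (by positivity)
    have : 0 ≤ K ^ α := by positivity
    linarith

end Growth

/-! ### Bounded measurable functions and conditioning on an event. -/

section Bounded

variable {Ω : Type*} {m0 : MeasurableSpace Ω}

/-- Bounded real functions measurable with respect to a given sigma-algebra. -/
def BddMeas (F : MeasurableSpace Ω) (f : Ω → ℝ) : Prop :=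
  Measurable[F] f ∧ ∃ B, ∀ ω, |f ω| ≤ B

namespace BddMeas

variable {F G : MeasurableSpace Ω} {f g : Ω → ℝ}

lemma mono (h : F ≤ G) (hf : BddMeas F f) : BddMeas G f :=
  ⟨hf.1.mono h le_rfl, hf.2⟩

lemma const (c : ℝ) : BddMeas F (fun _ => c) := ⟨measurable_const, |c|, fun _ => le_rfl⟩

lemma mul (hf : BddMeas F f) (hg : BddMeas F g) : BddMeas F (fun ω => f ω * g ω) := by
  obtain ⟨hf, A, hA⟩ := hf
  obtain ⟨hg, B, hB⟩ := hg
  refine ⟨Measurable.mul hf hg, A * B, fun ω => ?_⟩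
  rw [abs_mul]
  exact mul_le_mul (hA ω) (hB ω) (abs_nonneg _) ((abs_nonneg _).trans (hA ω))

lemma add (hf : BddMeas F f) (hg : BddMeas F g) : BddMeas F (fun ω => f ω + g ω) := by
  obtain ⟨hf, A, hA⟩ := hf
  obtain ⟨hg, B, hB⟩ := hg
  exact ⟨Measurable.add hf hg, A + B, fun ω => (abs_add_le _ _).trans (add_le_add (hA ω) (hB ω))⟩

lemma sub (hf : BddMeas F f) (hg : BddMeas F g) : BddMeas F (fun ω => f ω - g ω) := by
  obtain ⟨hf, A, hA⟩ := hf
  obtain ⟨hg, B, hB⟩ := hg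
  exact ⟨Measurable.sub hf hg, A + B, fun ω => (abs_sub _ _).trans (add_le_add (hA ω) (hB ω))⟩

lemma sum {f : ℕ → Ω → ℝ} (t : ℕ) (hf : ∀ s < t, BddMeas F (f s)) :
    BddMeas F (fun ω => ∑ s ∈ Finset.range t, f s ω) := by
  induction t with
  | zero => simpa using const 0
  | succ t ih =>
    simp only [Finset.sum_range_succ]
    exact (ih fun s hs => hf s (by omega)).add (hf t (by omega))

lemma indicator {E : Set Ω} (hE : MeasurableSet[F] E) :
    BddMeas F (E.indicator fun _ => (1 : ℝ)) := by
  refine ⟨Measurable.indicator measurable_const hE, 1, fun ω => ?_⟩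
  by_cases h : ω ∈ E <;> simp [h]

lemma comp_nat {X : Ω → ℕ} (hX : Measurable[F] X) {N : ℕ} (hN : ∀ ω, X ω ≤ N) (φ : ℕ → ℝ) :
    BddMeas F (fun ω => φ (X ω)) := by
  refine ⟨(measurable_from_top (f := φ)).comp hX, ∑ x ∈ Finset.range (N + 1), |φ x|, fun ω => ?_⟩
  exact Finset.single_le_sum (f := fun x => |φ x|) (fun _ _ => abs_nonneg _)
    (Finset.mem_range.2 (Nat.lt_succ_of_le (hN ω)))

lemma integrable {P : Measure[m0] Ω} [IsFiniteMeasure P] (hf : BddMeas m0 f) :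
    Integrable f P := by
  obtain ⟨h, B, hB⟩ := hf
  exact Integrable.of_bound h.aestronglyMeasurable B (ae_of_all _ hB)

/-- The only way in which the conditional law enters: under an integral, against a function of the
past, the jump indicator may be replaced by its conditional probability. -/
lemma integral_mul_indicator {P : Measure[m0] Ω} [IsProbabilityMeasure P] {p : Ω → ℝ} {E : Set Ω}
    (hF : F ≤ m0) (hf : BddMeas F f) (hE : MeasurableSet[m0] E)
    (hp : P[E.indicator (fun _ => (1 : ℝ)) | F] =ᵐ[P] p) :
    ∫ ω, f ω * E.indicator (fun _ => (1 : ℝ)) ω ∂P = ∫ ω, f ω * p ω ∂P := by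
  rw [← integral_condExp hF]
  refine integral_congr_ae ?_
  have h1 : P[fun ω => f ω * E.indicator (fun _ => (1 : ℝ)) ω | F] =ᵐ[P]
      f * P[E.indicator (fun _ => (1 : ℝ)) | F] :=
    condExp_mul_of_stronglyMeasurable_left hf.1.stronglyMeasurable
      ((hf.mono hF).mul (indicator hE)).integrable (indicator hE).integrable
  filter_upwards [h1, hp] with ω h1 h2
  rw [h1, Pi.mul_apply, h2]

end BddMeas

end Bounded

/-! ### Growth of inverse birth processes. -/

/-- A pure birth chain `X` on `ℕ`, adapted to `F`, which at time `t` jumps by one on the event `E t`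
whose conditional probability `p t` is, up to the factors `lo` and `hi`, equal to
`h t * (δ + X t)^(-α)`. -/
structure IsInverseBirthProcess {Ω : Type*} [m0 : MeasurableSpace Ω] (P : Measure Ω)
    (α δ lo hi : ℝ) (h : ℕ → ℝ) (F : ℕ → MeasurableSpace Ω) (X : ℕ → Ω → ℕ) (E : ℕ → Set Ω)
    (p : ℕ → Ω → ℝ) : Prop where
  mono : Monotone F
  le : ∀ t, F t ≤ m0
  measurable_X : ∀ t, Measurable[F t] (X t)
  measurable_p : ∀ t, Measurable[F t] (p t)
  measurableSet_E : ∀ t, MeasurableSet (E t)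
  jump : ∀ t, ∀ ω ∈ E t, X (t + 1) ω = X t ω + 1
  stay : ∀ t, ∀ ω ∉ E t, X (t + 1) ω = X t ω
  bounded_start : ∃ B, ∀ ω, X 0 ω ≤ B
  one_le : ∀ t ω, 1 ≤ δ + (X t ω : ℝ)
  condExp : ∀ t, P[(E t).indicator (fun _ => (1 : ℝ)) | F t] =ᵐ[P] p t
  nonneg : ∀ t ω, 0 ≤ p t ω
  lower : ∀ t ω, lo * h t ≤ p t ω * (δ + (X t ω : ℝ)) ^ α
  upper : ∀ t ω, p t ω * (δ + (X t ω : ℝ)) ^ α ≤ hi * h t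

namespace IsInverseBirthProcess

variable {Ω : Type*} [m0 : MeasurableSpace Ω] {P : Measure Ω}
  {α δ lo hi : ℝ} {h : ℕ → ℝ} {F : ℕ → MeasurableSpace Ω} {X : ℕ → Ω → ℕ} {E : ℕ → Set Ω}
  {p : ℕ → Ω → ℝ}

/-- The compensator of `(δ + X t)^(1+α)`. -/
noncomputable def compensator (α δ : ℝ) (X : ℕ → Ω → ℕ) (p : ℕ → Ω → ℝ) (t : ℕ) (ω : Ω) : ℝ :=
  ∑ s ∈ Finset.range t, powIncrement α (δ + X s ω) * p s ω

/-- The martingale part of `(δ + X t)^(1+α)`. -/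
noncomputable def martingalePart (α δ : ℝ) (X : ℕ → Ω → ℕ) (p : ℕ → Ω → ℝ) (t : ℕ) (ω : Ω) : ℝ :=
  (δ + X t ω) ^ (1 + α) - compensator α δ X p t ω

/-- At each fixed time the chain takes finitely many values, so all integrability questions below
are trivial. -/
lemma exists_bound (H : IsInverseBirthProcess P α δ lo hi h F X E p) (t : ℕ) :
    ∃ B, ∀ ω, X t ω ≤ B := by
  induction t with
  | zero => exact H.bounded_start
  | succ t ih =>
    obtain ⟨B, hB⟩ := ih
    refine ⟨B + 1, fun ω => ?_⟩
    by_cases hω : ω ∈ E t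
    · rw [H.jump t ω hω]; exact Nat.succ_le_succ (hB ω)
    · rw [H.stay t ω hω]; exact (hB ω).trans (Nat.le_succ _)

lemma bddMeas_comp (H : IsInverseBirthProcess P α δ lo hi h F X E p) (t : ℕ) (φ : ℕ → ℝ) :
    BddMeas (F t) (fun ω => φ (X t ω)) := by
  obtain ⟨B, hB⟩ := H.exists_bound t
  exact BddMeas.comp_nat (H.measurable_X t) hB φ

lemma bddMeas_p (H : IsInverseBirthProcess P α δ lo hi h F X E p) (hα : 0 < α) (t : ℕ) :
    BddMeas (F t) (p t) := by
  refine ⟨H.measurable_p t, hi * h t, fun ω => ?_⟩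
  rw [abs_of_nonneg (H.nonneg t ω)]
  refine le_trans ?_ (H.upper t ω)
  exact le_mul_of_one_le_right (H.nonneg t ω) (Real.one_le_rpow (H.one_le t ω) hα.le)

lemma bddMeas_compensator (H : IsInverseBirthProcess P α δ lo hi h F X E p) (hα : 0 < α)
    (t : ℕ) : BddMeas (F t) (compensator α δ X p t) :=
  BddMeas.sum t fun s hs => ((H.bddMeas_comp s fun x => powIncrement α (δ + x)).mul
    (H.bddMeas_p hα s)).mono (H.mono hs.le)

lemma bddMeas_martingalePart (H : IsInverseBirthProcess P α δ lo hi h F X E p) (hα : 0 < α)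
    (t : ℕ) : BddMeas (F t) (martingalePart α δ X p t) :=
  (H.bddMeas_comp t fun x => (δ + x) ^ (1 + α)).sub (H.bddMeas_compensator hα t)

lemma rpow_succ (H : IsInverseBirthProcess P α δ lo hi h F X E p) (t : ℕ) (ω : Ω) :
    (δ + X (t + 1) ω) ^ (1 + α) = (δ + X t ω) ^ (1 + α) +
      powIncrement α (δ + X t ω) * (E t).indicator (fun _ => (1 : ℝ)) ω := by
  by_cases hω : ω ∈ E t
  · rw [H.jump t ω hω, Set.indicator_of_mem hω, powIncrement]
    push_cast
    rw [← add_assoc]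
    ring
  · rw [H.stay t ω hω, Set.indicator_of_notMem hω]
    ring

lemma martingalePart_succ (H : IsInverseBirthProcess P α δ lo hi h F X E p) (t : ℕ) (ω : Ω) :
    martingalePart α δ X p (t + 1) ω = martingalePart α δ X p t ω +
      powIncrement α (δ + X t ω) * ((E t).indicator (fun _ => (1 : ℝ)) ω - p t ω) := by
  rw [martingalePart, martingalePart, H.rpow_succ, compensator, compensator,
    Finset.sum_range_succ]
  ring

/-- The exponent `1 + α` is chosen for this: the increment is comparable to `(δ + X t) ^ α`, the
reciprocal of the state dependence of `p t`, so the drift bounds are deterministic. -/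
lemma drift_bounds (H : IsInverseBirthProcess P α δ lo hi h F X E p) (hα : 0 < α) (t : ℕ)
    (ω : Ω) : lo * h t ≤ powIncrement α (δ + X t ω) * p t ω ∧
      powIncrement α (δ + X t ω) * p t ω ≤ (1 + α) * 2 ^ α * (hi * h t) := by
  obtain ⟨h1, h2⟩ := powIncrement_bounds hα (H.one_le t ω)
  constructor
  · refine (H.lower t ω).trans ?_
    rw [mul_comm]
    exact mul_le_mul_of_nonneg_right h1 (H.nonneg t ω)
  · refine (mul_le_mul_of_nonneg_right h2 (H.nonneg t ω)).trans ?_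
    rw [mul_assoc]
    refine mul_le_mul_of_nonneg_left ?_ (by positivity)
    rw [mul_comm]
    exact H.upper t ω

lemma compensator_bounds (H : IsInverseBirthProcess P α δ lo hi h F X E p) (hα : 0 < α) (t : ℕ)
    (ω : Ω) : lo * ∑ s ∈ Finset.range t, h s ≤ compensator α δ X p t ω ∧
      compensator α δ X p t ω ≤ (1 + α) * 2 ^ α * hi * ∑ s ∈ Finset.range t, h s := by
  rw [Finset.mul_sum, Finset.mul_sum, compensator]
  refine ⟨Finset.sum_le_sum fun s _ => (H.drift_bounds hα s ω).1,
    Finset.sum_le_sum fun s _ => ?_⟩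
  rw [mul_assoc]
  exact (H.drift_bounds hα s ω).2

lemma integral_rpow_le [IsProbabilityMeasure P]
    (H : IsInverseBirthProcess P α δ lo hi h F X E p) (hα : 0 < α) (t : ℕ) :
    ∫ ω, (δ + X t ω) ^ (1 + α) ∂P ≤ ∫ ω, (δ + X 0 ω) ^ (1 + α) ∂P +
      (1 + α) * 2 ^ α * hi * ∑ s ∈ Finset.range t, h s := by
  induction t with
  | zero => simp
  | succ t ih =>
    have hg := H.bddMeas_comp t fun x => powIncrement α (δ + x)
    have hI := BddMeas.indicator (H.measurableSet_E t)
    simp only [H.rpow_succ]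
    rw [integral_add ((H.bddMeas_comp t fun x => (δ + x) ^ (1 + α)).mono (H.le t)).integrable
      ((hg.mono (H.le t)).mul hI).integrable,
      BddMeas.integral_mul_indicator (H.le t) hg (H.measurableSet_E t) (H.condExp t),
      Finset.sum_range_succ]
    have : ∫ ω, powIncrement α (δ + X t ω) * p t ω ∂P ≤ (1 + α) * 2 ^ α * (hi * h t) := by
      have := integral_mono (μ := P) ((hg.mul (H.bddMeas_p hα t)).mono (H.le t)).integrable
        (integrable_const ((1 + α) * 2 ^ α * (hi * h t))) fun ω => (H.drift_bounds hα t ω).2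
      simpa using this
    linarith

lemma integral_sq_succ_le [IsProbabilityMeasure P]
    (H : IsInverseBirthProcess P α δ lo hi h F X E p) (hα : 0 < α) (t : ℕ) :
    ∫ ω, martingalePart α δ X p (t + 1) ω ^ 2 ∂P ≤ ∫ ω, martingalePart α δ X p t ω ^ 2 ∂P +
      ∫ ω, powIncrement α (δ + X t ω) * powIncrement α (δ + X t ω) * p t ω ∂P := by
  have hF := H.le t
  have hg := H.bddMeas_comp t fun x => powIncrement α (δ + x)
  have hp := H.bddMeas_p hα t
  have hM := H.bddMeas_martingalePart hα t
  have hI : BddMeas m0 _ := BddMeas.indicator (H.measurableSet_E t)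
  have key : ∀ f, BddMeas (F t) f → ∫ ω, f ω * (E t).indicator (fun _ => (1 : ℝ)) ω ∂P =
      ∫ ω, f ω * p t ω ∂P := fun f hf =>
    BddMeas.integral_mul_indicator hF hf (H.measurableSet_E t) (H.condExp t)
  have hf : BddMeas (F t) (fun ω => 2 * (martingalePart α δ X p t ω * powIncrement α (δ + X t ω)) +
      (powIncrement α (δ + X t ω) * powIncrement α (δ + X t ω) -
        2 * (powIncrement α (δ + X t ω) * powIncrement α (δ + X t ω) * p t ω))) :=
    ((BddMeas.const 2).mul (hM.mul hg)).add
      ((hg.mul hg).sub ((BddMeas.const 2).mul ((hg.mul hg).mul hp)))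
  have hr : BddMeas (F t) (fun ω => martingalePart α δ X p t ω * martingalePart α δ X p t ω -
      2 * (martingalePart α δ X p t ω * powIncrement α (δ + X t ω)) * p t ω +
      powIncrement α (δ + X t ω) * powIncrement α (δ + X t ω) * (p t ω * p t ω)) :=
    ((hM.mul hM).sub (((BddMeas.const 2).mul (hM.mul hg)).mul hp)).add
      ((hg.mul hg).mul (hp.mul hp))
  -- The indicator is idempotent, so the square is affine in it with coefficients measurable for `F
  -- t`. Replacing it by `p t` leaves `M² + g² p - g² p²`, with `M` the martingale part and `g` the
  -- increment; the last term is dropped.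
  have e1 : ∀ ω, martingalePart α δ X p (t + 1) ω ^ 2 =
      (2 * (martingalePart α δ X p t ω * powIncrement α (δ + X t ω)) +
      (powIncrement α (δ + X t ω) * powIncrement α (δ + X t ω) -
        2 * (powIncrement α (δ + X t ω) * powIncrement α (δ + X t ω) * p t ω))) *
          (E t).indicator (fun _ => (1 : ℝ)) ω +
      (martingalePart α δ X p t ω * martingalePart α δ X p t ω -
      2 * (martingalePart α δ X p t ω * powIncrement α (δ + X t ω)) * p t ω +
      powIncrement α (δ + X t ω) * powIncrement α (δ + X t ω) * (p t ω * p t ω)) := by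
    intro ω
    rw [H.martingalePart_succ]
    by_cases hω : ω ∈ E t
    · rw [Set.indicator_of_mem hω]; ring
    · rw [Set.indicator_of_notMem hω]; ring
  simp_rw [e1]
  rw [integral_add ((hf.mono hF).mul hI).integrable (hr.mono hF).integrable, key _ hf,
    ← integral_add ((hf.mul hp).mono hF).integrable (hr.mono hF).integrable,
    ← integral_add]
  · refine integral_mono (((hf.mul hp).add hr).mono hF).integrable ?_ fun ω => ?_
    · simp_rw [pow_two]
      exact (((hM.mul hM).add ((hg.mul hg).mul hp)).mono hF).integrable
    · dsimp only
      nlinarith [mul_self_nonneg (powIncrement α (δ + X t ω) * p t ω)]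
  · simp_rw [pow_two]
    exact ((hM.mul hM).mono hF).integrable
  · exact (((hg.mul hg).mul hp).mono hF).integrable

lemma integral_quadratic_le [IsProbabilityMeasure P]
    (H : IsInverseBirthProcess P α δ lo hi h F X E p) (hα : 0 < α) (hhi : 0 ≤ hi)
    (hh : ∀ t, 0 ≤ h t) {K : ℝ} (hK : 0 < K) (t : ℕ) :
    ∫ ω, powIncrement α (δ + X t ω) * powIncrement α (δ + X t ω) * p t ω ∂P ≤
      ((1 + α) * 2 ^ α) ^ 2 * hi * h t *
        ((∫ ω, (δ + X 0 ω) ^ (1 + α) ∂P +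
          (1 + α) * 2 ^ α * hi * ∑ s ∈ Finset.range t, h s) / K + K ^ α) := by
  have hF := H.le t
  have hg := H.bddMeas_comp t fun x => powIncrement α (δ + x)
  have hp := H.bddMeas_p hα t
  have hZ := H.bddMeas_comp t fun x => (δ + x) ^ (1 + α)
  have hZK : BddMeas (F t) (fun ω => (δ + X t ω) ^ (1 + α) / K + K ^ α) :=
    H.bddMeas_comp t fun x => (δ + x) ^ (1 + α) / K + K ^ α
  have hc : 0 ≤ ((1 + α) * 2 ^ α) ^ 2 * hi * h t := by
    have := hh t
    positivity
  have e1 : ∫ ω, powIncrement α (δ + X t ω) * powIncrement α (δ + X t ω) * p t ω ∂P ≤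
      ∫ ω, ((1 + α) * 2 ^ α) ^ 2 * hi * h t * ((δ + X t ω) ^ (1 + α) / K + K ^ α) ∂P := by
    refine integral_mono (((hg.mul hg).mul hp).mono hF).integrable
      (((BddMeas.const _).mul hZK).mono hF).integrable fun ω => ?_
    dsimp only
    obtain ⟨h1, h2⟩ := powIncrement_bounds hα (H.one_le t ω)
    have hy : 0 ≤ (δ + X t ω) ^ α := Real.rpow_nonneg (by linarith [H.one_le t ω]) _
    -- One increment is absorbed with `p t` into the drift bound; the other leaves a single factor
    -- `(δ + X t) ^ α`.
    calc powIncrement α (δ + X t ω) * powIncrement α (δ + X t ω) * p t ω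
        = powIncrement α (δ + X t ω) * (powIncrement α (δ + X t ω) * p t ω) := by ring
      _ ≤ ((1 + α) * 2 ^ α * (δ + X t ω) ^ α) * ((1 + α) * 2 ^ α * (hi * h t)) :=
          mul_le_mul h2 (H.drift_bounds hα t ω).2
            (mul_nonneg (hy.trans h1) (H.nonneg t ω)) (by positivity)
      _ = ((1 + α) * 2 ^ α) ^ 2 * hi * h t * (δ + X t ω) ^ α := by ring
      _ ≤ _ := mul_le_mul_of_nonneg_left (rpow_le_div_add hα (H.one_le t ω) hK) hc
  refine e1.trans ?_
  rw [integral_const_mul]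
  refine mul_le_mul_of_nonneg_left ?_ hc
  rw [integral_add ((hZ.mono hF).integrable.div_const K) (integrable_const _), integral_div]
  simp only [integral_const, probReal_univ, one_smul]
  gcongr
  exact H.integral_rpow_le hα t

/-- The horizon `T` is separate from `t` so that the last factor stays fixed during the induction.
-/
lemma integral_sq_le [IsProbabilityMeasure P]
    (H : IsInverseBirthProcess P α δ lo hi h F X E p) (hα : 0 < α) (hhi : 0 ≤ hi)
    (hh : ∀ t, 0 ≤ h t) {K : ℝ} (hK : 0 < K) {t T : ℕ} (htT : t ≤ T) :
    ∫ ω, martingalePart α δ X p t ω ^ 2 ∂P ≤ ∫ ω, martingalePart α δ X p 0 ω ^ 2 ∂P +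
      ((1 + α) * 2 ^ α) ^ 2 * hi * (∑ s ∈ Finset.range t, h s) *
        ((∫ ω, (δ + X 0 ω) ^ (1 + α) ∂P +
          (1 + α) * 2 ^ α * hi * ∑ s ∈ Finset.range T, h s) / K + K ^ α) := by
  induction t with
  | zero => simp
  | succ t ih =>
    refine (H.integral_sq_succ_le hα t).trans ?_
    have h1 := ih (by omega)
    have h2 := H.integral_quadratic_le hα hhi hh hK t
    have h3 : ∑ s ∈ Finset.range t, h s ≤ ∑ s ∈ Finset.range T, h s :=
      Finset.sum_le_sum_of_subset_of_nonneg (Finset.range_subset_range.2 (by omega))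
        fun s _ _ => hh s
    have h4 : ((1 + α) * 2 ^ α) ^ 2 * hi * h t *
        ((∫ ω, (δ + X 0 ω) ^ (1 + α) ∂P +
          (1 + α) * 2 ^ α * hi * ∑ s ∈ Finset.range t, h s) / K + K ^ α) ≤
        ((1 + α) * 2 ^ α) ^ 2 * hi * h t *
        ((∫ ω, (δ + X 0 ω) ^ (1 + α) ∂P +
          (1 + α) * 2 ^ α * hi * ∑ s ∈ Finset.range T, h s) / K + K ^ α) := by
      have := hh t
      gcongr
    rw [Finset.sum_range_succ, mul_add (((1 + α) * 2 ^ α) ^ 2 * hi),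
      add_mul (((1 + α) * 2 ^ α) ^ 2 * hi * _)]
    linarith

lemma tendsto_integral_sq_div [IsProbabilityMeasure P]
    (H : IsInverseBirthProcess P α δ lo hi h F X E p) (hα : 0 < α) (hhi : 0 ≤ hi)
    (hh : ∀ t, 0 ≤ h t) (hdiv : Tendsto (fun t => ∑ s ∈ Finset.range t, h s) atTop atTop) :
    Tendsto (fun t => (∫ ω, martingalePart α δ X p t ω ^ 2 ∂P) /
      (∑ s ∈ Finset.range t, h s) ^ 2) atTop (𝓝 0) := by
  set S : ℕ → ℝ := fun t => ∑ s ∈ Finset.range t, h s with hS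
  set A := ∫ ω, martingalePart α δ X p 0 ω ^ 2 ∂P
  set B := ∫ ω, (δ + X 0 ω) ^ (1 + α) ∂P
  set κ := (1 + α) * 2 ^ α
  have hα1 : (0 : ℝ) < 1 + α := by linarith
  have hinv : Tendsto (fun t => (S t)⁻¹) atTop (𝓝 0) := tendsto_inv_atTop_zero.comp hdiv
  have hKinv : Tendsto (fun t => (S t ^ (1 + α)⁻¹)⁻¹) atTop (𝓝 0) :=
    tendsto_inv_atTop_zero.comp ((tendsto_rpow_atTop (by positivity)).comp hdiv)
  have hlim : Tendsto (fun t => A * ((S t)⁻¹ * (S t)⁻¹) +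
      κ ^ 2 * hi * (B * (S t)⁻¹ + κ * hi + 1) * (S t ^ (1 + α)⁻¹)⁻¹) atTop
      (𝓝 (A * (0 * 0) + κ ^ 2 * hi * (B * 0 + κ * hi + 1) * 0)) :=
    ((hinv.mul hinv).const_mul A).add
      (((((hinv.const_mul B).add_const _).add_const _).const_mul _).mul hKinv)
  rw [show A * (0 * 0) + κ ^ 2 * hi * (B * 0 + κ * hi + 1) * 0 = 0 by ring] at hlim
  refine squeeze_zero' (Eventually.of_forall fun t =>
    div_nonneg (integral_nonneg fun ω => sq_nonneg _) (sq_nonneg _)) ?_ hlim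
  filter_upwards [hdiv.eventually_gt_atTop 0] with t ht
  change 0 < S t at ht
  -- With `K = S ^ (1 / (1 + α))` the terms `S / K` and `K ^ α` coincide.
  have hK : 0 < S t ^ (1 + α)⁻¹ := by positivity
  have hKα : (S t ^ (1 + α)⁻¹) ^ α = S t / S t ^ (1 + α)⁻¹ := by
    rw [eq_div_iff hK.ne', mul_comm]
    nth_rewrite 1 [← Real.rpow_one (S t ^ (1 + α)⁻¹)]
    rw [← Real.rpow_add hK, ← Real.rpow_mul ht.le, inv_mul_cancel₀ hα1.ne', Real.rpow_one]
  have h1 := H.integral_sq_le hα hhi hh hK (le_refl t)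
  rw [hKα] at h1
  rw [div_le_iff₀ (by positivity)]
  refine h1.trans (le_of_eq ?_)
  change A + κ ^ 2 * hi * S t * ((B + κ * hi * S t) / S t ^ (1 + α)⁻¹ + S t / S t ^ (1 + α)⁻¹) =
    _ * S t ^ 2
  field_simp

/-- The chain grows like `(∑ h)^(1/(1+α))` with probability tending to one. -/
theorem tendsto_measure [IsProbabilityMeasure P]
    (H : IsInverseBirthProcess P α δ lo hi h F X E p) (hα : 0 < α) (hlo : 0 < lo) (hhi : 0 ≤ hi)
    (hh : ∀ t, 0 ≤ h t) (hdiv : Tendsto (fun t => ∑ s ∈ Finset.range t, h s) atTop atTop) :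
    Tendsto (fun t => P {ω | lo / 2 * ∑ s ∈ Finset.range t, h s ≤ (δ + X t ω) ^ (1 + α) ∧
      (δ + X t ω) ^ (1 + α) ≤ ((1 + α) * 2 ^ α * hi + lo) * ∑ s ∈ Finset.range t, h s})
      atTop (𝓝 1) := by
  set S : ℕ → ℝ := fun t => ∑ s ∈ Finset.range t, h s with hS
  have h0 := (H.tendsto_integral_sq_div hα hhi hh hdiv).const_mul ((lo / 2) ^ 2)⁻¹
  rw [mul_zero] at h0
  have h1 := (ENNReal.tendsto_ofReal h0)
  rw [ENNReal.ofReal_zero] at h1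
  have h2 := ENNReal.Tendsto.sub (tendsto_const_nhds (x := (1 : ENNReal)) (f := atTop)) h1
    (Or.inl ENNReal.one_ne_top)
  rw [tsub_zero] at h2
  refine tendsto_of_tendsto_of_tendsto_of_le_of_le' h2 tendsto_const_nhds ?_
    (Eventually.of_forall fun t => prob_le_one)
  filter_upwards [hdiv.eventually_gt_atTop 0] with t ht
  change 0 < S t at ht
  -- Off this event the martingale part is smaller than half of the least possible compensator `lo *
  -- S t`.
  set bad : Set Ω := {ω | (lo / 2 * S t) ^ 2 ≤ martingalePart α δ X p t ω ^ 2}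
  have hMb := (H.bddMeas_martingalePart hα t).mono (H.le t)
  have hMi : Integrable (fun ω => martingalePart α δ X p t ω ^ 2) P := by
    simp_rw [pow_two]
    exact (hMb.mul hMb).integrable
  have hbm : MeasurableSet bad := measurableSet_le measurable_const (hMb.1.pow_const 2)
  have hbad : P bad ≤ ENNReal.ofReal (((lo / 2) ^ 2)⁻¹ *
      ((∫ ω, martingalePart α δ X p t ω ^ 2 ∂P) / S t ^ 2)) := by
    rw [← ofReal_measureReal (μ := P) (s := bad)]
    refine ENNReal.ofReal_le_ofReal ?_
    have := mul_meas_ge_le_integral_of_nonneg (μ := P)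
      (ae_of_all _ fun ω => sq_nonneg (martingalePart α δ X p t ω)) hMi ((lo / 2 * S t) ^ 2)
    rw [inv_mul_eq_div, div_div, ← mul_pow, mul_comm (S t), le_div_iff₀ (by positivity), mul_comm]
    exact this
  refine (tsub_le_tsub_left hbad 1).trans ?_
  rw [← prob_compl_eq_one_sub hbm]
  refine measure_mono fun ω hω => ?_
  have hω' : ¬ ((lo / 2 * S t) ^ 2 ≤ martingalePart α δ X p t ω ^ 2) := hω
  rw [not_le, sq_lt_sq, abs_of_pos (by positivity : 0 < lo / 2 * S t), abs_lt] at hω'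
  obtain ⟨c1, c2⟩ := H.compensator_bounds hα t ω
  rw [martingalePart] at hω'
  change lo * S t ≤ _ at c1
  change _ ≤ (1 + α) * 2 ^ α * hi * S t at c2
  have : 0 < lo * S t := by positivity
  constructor
  · change lo / 2 * S t ≤ _
    linarith [hω'.1]
  · change _ ≤ ((1 + α) * 2 ^ α * hi + lo) * S t
    linarith [hω'.2]

end IsInverseBirthProcess

/-! ### Half-edge labels and degree counts. -/

section Combinatorics

/-- The pair `(n, k)` is run by one clock `t = m * n + k`. At a carry, `m` half-edges of `v_{n+1}`
attached is the same label set as `n + 1` complete vertices. -/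
lemma halfEdges_div_mod_succ {m : ℕ} (hm : 0 < m) (t : ℕ) :
    halfEdges m ((t + 1) / m) ((t + 1) % m) = halfEdges m (t / m) (t % m + 1) := by
  have hlt := Nat.mod_lt t hm
  have hdm := Nat.div_add_mod t m
  rcases Nat.lt_or_ge (t % m + 1) m with h | h
  · obtain ⟨h1, h2⟩ := (Nat.div_mod_unique hm).2
      (⟨by omega, h⟩ : t % m + 1 + m * (t / m) = t + 1 ∧ t % m + 1 < m)
    rw [h1, h2]
  · obtain ⟨h1, h2⟩ := (Nat.div_mod_unique hm).2
      (⟨by rw [mul_add]; omega, hm⟩ : 0 + m * (t / m + 1) = t + 1 ∧ 0 < m)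
    have h3 : t % m + 1 = m := by omega
    rw [h1, h2, h3]
    generalize t / m = q
    ext ⟨l, r⟩
    simp only [halfEdges, Finset.mem_union, Finset.mem_product, Finset.mem_Icc, Finset.mem_range,
      Finset.mem_singleton]
    omega

lemma attached_succ {m n k : ℕ} (hn : 1 ≤ n) :
    attached m n (k + 1) = insert (n + 1, k) (attached m n k) := by
  ext ⟨l, r⟩
  simp only [attached, halfEdges, Finset.mem_insert, Finset.mem_filter, Finset.mem_union,
    Finset.mem_product, Finset.mem_Icc, Finset.mem_range, Finset.mem_singleton, Prod.mk.injEq]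
  omega

lemma notMem_attached (m n k : ℕ) : (n + 1, k) ∉ attached m n k := by
  simp [attached, halfEdges]

lemma card_own {m n k i : ℕ} (hi : 1 ≤ i) (hin : i ≤ n) :
    ((halfEdges m n k).filter fun p => p.1 = i).card = m := by
  have : ((halfEdges m n k).filter fun p => p.1 = i) = {i} ×ˢ Finset.range m := by
    ext ⟨l, r⟩
    simp only [halfEdges, Finset.mem_filter, Finset.mem_union, Finset.mem_product, Finset.mem_Icc,
      Finset.mem_range, Finset.mem_singleton]
    omega
  rw [this, Finset.card_product]
  simp

lemma degree_eq {m n k i : ℕ} (e : ℕ → ℕ → ℕ) (hi : 1 ≤ i) (hin : i ≤ n) :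
    degree m e i n k = m + ((attached m n k).filter fun p => e p.1 p.2 = i).card := by
  rw [degree, card_own hi hin]

lemma degree_succ {m n k i : ℕ} (e : ℕ → ℕ → ℕ) (hi : 1 ≤ i) (hin : i ≤ n) :
    degree m e i n (k + 1) = degree m e i n k + if e (n + 1) k = i then 1 else 0 := by
  rw [degree_eq e hi hin, degree_eq e hi hin, attached_succ (hi.trans hin), Finset.filter_insert]
  split_ifs with h
  · rw [Finset.card_insert_of_notMem fun h' => notMem_attached m n k (Finset.mem_filter.1 h').1,
      add_assoc]
  · rfl

lemma card_attached_le {m n k : ℕ} (hn : 1 ≤ n) (hk : k ≤ m) :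
    (attached m n k).card ≤ 2 * m * n := by
  refine (Finset.card_filter_le _ _).trans ((Finset.card_union_le _ _).trans ?_)
  simp only [Finset.card_product, Nat.card_Icc, Finset.card_range, Finset.card_singleton,
    add_tsub_cancel_right, one_mul]
  nlinarith

lemma degree_le {m n k i : ℕ} (e : ℕ → ℕ → ℕ) (hi : 1 ≤ i) (hin : i ≤ n) (hk : k ≤ m) :
    degree m e i n k ≤ m + 2 * m * n := by
  rw [degree_eq e hi hin]
  exact Nat.add_le_add_left
    ((Finset.card_filter_le _ _).trans (card_attached_le (hi.trans hin) hk)) _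

lemma sum_degree_le {m n k : ℕ} (e : ℕ → ℕ → ℕ) (hn : 1 ≤ n) (hk : k ≤ m) :
    ∑ j ∈ Finset.Icc 1 n, degree m e j n k ≤ 3 * m * n := by
  have h1 : ∑ j ∈ Finset.Icc 1 n, ((attached m n k).filter fun p => e p.1 p.2 = j).card ≤
      (attached m n k).card := by
    rw [Finset.sum_card_fiberwise_eq_card_filter]
    exact Finset.card_filter_le _ _
  have h2 : ∑ j ∈ Finset.Icc 1 n, degree m e j n k = ∑ j ∈ Finset.Icc 1 n,
      (m + ((attached m n k).filter fun p => e p.1 p.2 = j).card) :=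
    Finset.sum_congr rfl fun j hj =>
      degree_eq e (Finset.mem_Icc.1 hj).1 (Finset.mem_Icc.1 hj).2
  rw [h2, Finset.sum_add_distrib]
  have h3 := card_attached_le (m := m) hn hk
  simp only [Finset.sum_const, Nat.card_Icc, add_tsub_cancel_right, smul_eq_mul]
  nlinarith

end Combinatorics

/-! ### The total weight is of order `n`. -/

section Weights

variable {m : ℕ} {α δ : ℝ}

/-- With `m ≥ 2` the own half-edges alone keep the shifted degree above `1`, uniformly in `δ > -1`.
-/
lemma one_le_shift_degree (hm : 1 < m) (hδ : -1 < δ) {n k i : ℕ} (e : ℕ → ℕ → ℕ) (hi : 1 ≤ i)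
    (hin : i ≤ n) : (m : ℝ) ≤ degree m e i n k ∧ 1 ≤ δ + (degree m e i n k : ℝ) := by
  have h1 : (m : ℝ) ≤ degree m e i n k := by
    rw [degree_eq e hi hin]
    exact_mod_cast Nat.le_add_right _ _
  have h2 : (2 : ℝ) ≤ m := by exact_mod_cast hm
  exact ⟨h1, by linarith⟩

lemma sum_weight_le (hm : 1 < m) (hα : 0 < α) (hδ : -1 < δ) (e : ℕ → ℕ → ℕ) (n k : ℕ) :
    ∑ j ∈ Finset.Icc 1 n, weight m α δ e j n k ≤ n := by
  have : ∑ j ∈ Finset.Icc 1 n, weight m α δ e j n k ≤ ∑ j ∈ Finset.Icc 1 n, (1 : ℝ) := by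
    refine Finset.sum_le_sum fun j hj => ?_
    obtain ⟨h1, h2⟩ := Finset.mem_Icc.1 hj
    have h3 := Real.one_le_rpow (one_le_shift_degree hm hδ (k := k) e h1 h2).2 hα.le
    rw [weight, div_le_one (by linarith)]
    exact h3
  simpa using this

lemma le_sum_weight (hm : 1 < m) (hα : 0 < α) (hδ : -1 < δ) (e : ℕ → ℕ → ℕ) {n k : ℕ}
    (hn : 1 ≤ n) (hk : k ≤ m) :
    (1 / (2 * (δ + 6 * m) ^ α)) * n ≤ ∑ j ∈ Finset.Icc 1 n, weight m α δ e j n k := by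
  have hm2 : (2 : ℝ) ≤ m := by exact_mod_cast hm
  have hW : 0 < (δ + 6 * (m : ℝ)) ^ α := Real.rpow_pos_of_pos (by linarith) _
  -- A linear form of Markov's inequality: the bound is useful for degrees below `6 * m` and
  -- nonpositive beyond. As the mean degree is at most `3 * m`, the bracket averages to at least `1
  -- / 2`.
  have key : ∀ j ∈ Finset.Icc 1 n, 1 / (δ + 6 * (m : ℝ)) ^ α *
      (1 - (degree m e j n k : ℝ) / (6 * m)) ≤ weight m α δ e j n k := by
    intro j hj
    obtain ⟨h1, h2⟩ := Finset.mem_Icc.1 hj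
    have h3 := (one_le_shift_degree hm hδ (k := k) e h1 h2).2
    have hw : 0 < (δ + (degree m e j n k : ℝ)) ^ α := Real.rpow_pos_of_pos (by linarith) _
    rcases le_total (degree m e j n k : ℝ) (6 * m) with h | h
    · have h4 : (δ + (degree m e j n k : ℝ)) ^ α ≤ (δ + 6 * (m : ℝ)) ^ α :=
        Real.rpow_le_rpow (by linarith) (by linarith) hα.le
      have h5 : 0 ≤ (degree m e j n k : ℝ) / (6 * m) := by positivity
      calc _ ≤ 1 / (δ + 6 * (m : ℝ)) ^ α :=
            mul_le_of_le_one_right (by positivity) (by linarith)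
        _ ≤ _ := one_div_le_one_div_of_le hw h4
    · have h5 : 1 ≤ (degree m e j n k : ℝ) / (6 * m) := by
        rw [le_div_iff₀ (by linarith)]; linarith
      have h6 : 0 ≤ weight m α δ e j n k := by rw [weight]; positivity
      exact (mul_nonpos_of_nonneg_of_nonpos (by positivity) (by linarith)).trans h6
  refine le_trans ?_ (Finset.sum_le_sum key)
  rw [← Finset.mul_sum, Finset.sum_sub_distrib, ← Finset.sum_div, ← Nat.cast_sum]
  have h7 : ((∑ j ∈ Finset.Icc 1 n, degree m e j n k : ℕ) : ℝ) ≤ 3 * m * n := by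
    exact_mod_cast sum_degree_le e hn hk
  have h8 : ((∑ j ∈ Finset.Icc 1 n, degree m e j n k : ℕ) : ℝ) / (6 * m) ≤ n / 2 := by
    rw [div_le_iff₀ (by linarith)]; linarith
  simp only [Finset.sum_const, Nat.card_Icc, add_tsub_cancel_right, nsmul_eq_mul, mul_one]
  calc _ = 1 / (δ + 6 * (m : ℝ)) ^ α * (n / 2) := by field_simp
    _ ≤ _ := mul_le_mul_of_nonneg_left (by linarith) (by positivity)

end Weights

/-! ### Measurability with respect to the history. -/

section Measurability

variable {Ω : Type*} {m : ℕ} {e : ℕ → ℕ → Ω → ℕ}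

lemma history_mono {n k n' k' : ℕ} (h : attached m n k ⊆ attached m n' k') :
    history m e n k ≤ history m e n' k' :=
  biSup_mono h

lemma measurable_degree (i n k : ℕ) :
    Measurable[history m e n k] (fun ω => degree m (fun l r => e l r ω) i n k) := by
  unfold degree
  refine Measurable.const_add (m := history m e n k) ?_ _
  simp only [Finset.card_filter]
  refine Finset.measurable_fun_sum _ fun p hp => ?_
  have h1 : Measurable[MeasurableSpace.comap (e p.1 p.2) ⊤] (e p.1 p.2) := comap_measurable _
  have h2 : Measurable[history m e n k] (e p.1 p.2) :=
    h1.mono (le_iSup₂_of_le p hp le_rfl) le_rfl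
  exact (measurable_from_top (f := fun x : ℕ => if x = i then 1 else 0)).comp h2

lemma measurable_weight (α δ : ℝ) (i n k : ℕ) :
    Measurable[history m e n k] (fun ω => weight m α δ (fun l r => e l r ω) i n k) :=
  (measurable_from_top (f := fun x : ℕ => 1 / (δ + (x : ℝ)) ^ α)).comp (measurable_degree i n k)

lemma IsInverseDePreferential.history_le {m0 : MeasurableSpace Ω} {P : Measure Ω} {α δ : ℝ}
    (he : IsInverseDePreferential m α δ P e) {n k : ℕ} (hk : k ≤ m) :
    history m e n k ≤ m0 := by
  refine iSup₂_le fun p hp => ?_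
  refine (he.measurable_endpoint p.1 p.2 (Finset.mem_filter.1 hp).2 ?_).comap_le
  have := (Finset.mem_filter.1 hp).1
  simp only [halfEdges, Finset.mem_union, Finset.mem_product, Finset.mem_range] at this
  omega

end Measurability
-- From the graph to the birth process.
/-- The degree of `v_i`, followed half-edge by half-edge from the arrival of `v_{i+1}` on, is an
inverse birth process. -/
theorem IsInverseDePreferential.isInverseBirthProcess {Ω : Type*} [MeasurableSpace Ω] {m : ℕ}
    {α δ : ℝ} {P : Measure Ω} {e : ℕ → ℕ → Ω → ℕ} (he : IsInverseDePreferential m α δ P e)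
    (hm : 1 < m) (hα : 0 < α) (hδ : -1 < δ) {i : ℕ} (hi : 1 ≤ i) :
    IsInverseBirthProcess P α δ 1 (4 * m * (δ + 6 * m) ^ α)
      (fun t => 1 / ((m * i + t + 1 : ℕ) : ℝ))
      (fun t => history m e ((m * i + t) / m) ((m * i + t) % m))
      (fun t ω => degree m (fun l r => e l r ω) i ((m * i + t) / m) ((m * i + t) % m))
      (fun t => {ω | e ((m * i + t) / m + 1) ((m * i + t) % m) ω = i})
      (fun t ω => weight m α δ (fun l r => e l r ω) i ((m * i + t) / m) ((m * i + t) % m) /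
        ∑ j ∈ Finset.Icc 1 ((m * i + t) / m),
          weight m α δ (fun l r => e l r ω) j ((m * i + t) / m) ((m * i + t) % m)) := by
  have hm0 : 0 < m := by omega
  have hm2 : (2 : ℝ) ≤ m := by exact_mod_cast hm
  -- The clock starts at `m * i`, when `G_i` is complete, so `v_i` is always among the possible
  -- targets.
  have hin : ∀ t, i ≤ (m * i + t) / m := fun t => by
    rw [Nat.le_div_iff_mul_le hm0, mul_comm]
    omega
  have hmod : ∀ t, (m * i + t) % m < m := fun t => Nat.mod_lt _ hm0
  have hstep : ∀ t ω, degree m (fun l r => e l r ω) i ((m * i + (t + 1)) / m)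
      ((m * i + (t + 1)) % m) =
      degree m (fun l r => e l r ω) i ((m * i + t) / m) ((m * i + t) % m) +
        if e ((m * i + t) / m + 1) ((m * i + t) % m) ω = i then 1 else 0 := by
    intro t ω
    rw [← degree_succ (fun l r => e l r ω) hi (hin t), ← add_assoc]
    simp only [degree, attached, halfEdges_div_mod_succ hm0]
  have hone : ∀ t ω, 1 ≤ δ +
      (degree m (fun l r => e l r ω) i ((m * i + t) / m) ((m * i + t) % m) : ℝ) :=
    fun t ω => (one_le_shift_degree hm hδ _ hi (hin t)).2
  have hW : 0 < (δ + 6 * (m : ℝ)) ^ α := Real.rpow_pos_of_pos (by linarith) _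
  have hlow : ∀ t ω, _ := fun t ω => le_sum_weight hm hα hδ (fun l r => e l r ω)
    (hi.trans (hin t)) (hmod t).le
  have hnpos : ∀ t, (0 : ℝ) < ((m * i + t) / m : ℕ) := fun t =>
    Nat.cast_pos.2 (hi.trans (hin t))
  have hpos : ∀ t ω, 0 < ∑ j ∈ Finset.Icc 1 ((m * i + t) / m),
      weight m α δ (fun l r => e l r ω) j ((m * i + t) / m) ((m * i + t) % m) := fun t ω =>
    lt_of_lt_of_le (mul_pos (by positivity) (hnpos t)) (hlow t ω)
  -- The weight of `v_i` cancels, so both rate bounds reduce to bounds on the total weight.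
  have hprod : ∀ t ω, weight m α δ (fun l r => e l r ω) i ((m * i + t) / m) ((m * i + t) % m) /
        (∑ j ∈ Finset.Icc 1 ((m * i + t) / m),
          weight m α δ (fun l r => e l r ω) j ((m * i + t) / m) ((m * i + t) % m)) *
        (δ + (degree m (fun l r => e l r ω) i ((m * i + t) / m) ((m * i + t) % m) : ℝ)) ^ α =
      1 / ∑ j ∈ Finset.Icc 1 ((m * i + t) / m),
          weight m α δ (fun l r => e l r ω) j ((m * i + t) / m) ((m * i + t) % m) := by
    intro t ω
    have h1 := Real.rpow_pos_of_pos (zero_lt_one.trans_le (hone t ω)) α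
    rw [div_mul_eq_mul_div]
    congr 1
    rw [weight, one_div_mul_cancel h1.ne']
  refine
    { mono := monotone_nat_of_le_succ fun t => history_mono ?_
      le := fun t => he.history_le (hmod t).le
      measurable_X := fun t => measurable_degree _ _ _
      measurable_p := fun t => (measurable_weight _ _ _ _ _).div
        (Finset.measurable_fun_sum _ fun j _ => measurable_weight _ _ _ _ _)
      measurableSet_E := fun t =>
        he.measurable_endpoint _ _ (by have := hi.trans (hin t); omega) (hmod t)
          (measurableSet_singleton i)
      jump := fun t ω hω => by rw [hstep t ω]; exact congrArg _ (if_pos hω)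
      stay := fun t ω hω => by rw [hstep t ω]; exact congrArg _ (if_neg hω)
      bounded_start := ⟨_, fun ω => degree_le _ hi (hin 0) (hmod 0).le⟩
      one_le := hone
      condExp := fun t => he.attachment _ _ i (hi.trans (hin t)) (hmod t) hi (hin t)
      nonneg := fun t ω => div_nonneg
        (one_div_nonneg.2 (Real.rpow_nonneg (zero_le_one.trans (hone t ω)) _)) (hpos t ω).le
      lower := fun t ω => ?_
      upper := fun t ω => ?_ }
  · rw [← add_assoc]
    have h1 : attached m ((m * i + t + 1) / m) ((m * i + t + 1) % m) =
        attached m ((m * i + t) / m) ((m * i + t) % m + 1) := by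
      simp only [attached, halfEdges_div_mod_succ hm0]
    rw [h1, attached_succ (hi.trans (hin t))]
    exact Finset.subset_insert _ _
  · rw [hprod, one_mul]
    refine one_div_le_one_div_of_le (hpos t ω) ?_
    refine (sum_weight_le hm hα hδ _ _ _).trans ?_
    exact_mod_cast (Nat.div_le_self _ _).trans (Nat.le_succ _)
  · rw [hprod, mul_one_div, div_le_div_iff₀ (hpos t ω) (by positivity), one_mul]
    -- Passing from the vertex count `n` to the clock costs `2 * m`; the total weight bound costs `2
    -- * (δ + 6 * m) ^ α`. Their product is the constant `hi`.
    have h1 : ((m * i + t + 1 : ℕ) : ℝ) ≤ 2 * m * ((m * i + t) / m : ℕ) := by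
      have h2 := Nat.div_add_mod (m * i + t) m
      have h3 := hmod t
      have h4 : m ≤ m * ((m * i + t) / m) := Nat.le_mul_of_pos_right _ (hi.trans (hin t))
      have h5 : m * i + t + 1 ≤ 2 * (m * ((m * i + t) / m)) := by omega
      rw [mul_assoc]
      exact_mod_cast h5
    refine h1.trans ?_
    calc 2 * (m : ℝ) * ((m * i + t) / m : ℕ)
        = 4 * m * (δ + 6 * m) ^ α * ((1 / (2 * (δ + 6 * m) ^ α)) * ((m * i + t) / m : ℕ)) := by
          generalize (δ + 6 * (m : ℝ)) ^ α = W at hW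
          field_simp
          ring
      _ ≤ _ := mul_le_mul_of_nonneg_left (hlow t ω) (by positivity)

/-! ### Harmonic sums and the logarithm. -/

lemma sum_shifted_harmonic (a t : ℕ) :
    ∑ s ∈ Finset.range t, 1 / ((a + s + 1 : ℕ) : ℝ) = (harmonic (a + t) : ℝ) - harmonic a := by
  induction t with
  | zero => simp
  | succ t ih =>
    rw [Finset.sum_range_succ, ih, ← add_assoc, harmonic_succ]
    push_cast
    ring

lemma tendsto_log_natCast : Tendsto (fun n : ℕ => Real.log n) atTop atTop :=
  Real.tendsto_log_atTop.comp tendsto_natCast_atTop_atTop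

lemma log_le_harmonic {n : ℕ} (hn : 0 < n) : Real.log n ≤ harmonic n :=
  (Real.log_le_log (by exact_mod_cast hn) (by exact_mod_cast Nat.le_succ n)).trans
    (log_add_one_le_harmonic n)

lemma tendsto_sum_shifted_harmonic (a : ℕ) :
    Tendsto (fun t => ∑ s ∈ Finset.range t, 1 / ((a + s + 1 : ℕ) : ℝ)) atTop atTop := by
  simp_rw [sum_shifted_harmonic]
  refine tendsto_atTop_add_const_right _ _ ?_
  refine tendsto_atTop_mono' _ ?_ tendsto_log_natCast
  filter_upwards [eventually_gt_atTop 0] with t ht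
  refine le_trans (Real.log_le_log (by exact_mod_cast ht) ?_) (log_le_harmonic (by omega))
  exact_mod_cast Nat.le_add_left t a

/-- The clock reaches `G_n` after `m * n - m * i` steps. The offsets `harmonic (m * i)` and `1 + log
m` are absorbed by factors of two once `n` is large, which removes `i` from the constants. -/
lemma eventually_sum_shifted_harmonic_bounds {m : ℕ} (hm : 0 < m) (i : ℕ) :
    ∀ᶠ n : ℕ in atTop, Real.log n / 2 ≤
        ∑ s ∈ Finset.range (m * n - m * i), 1 / ((m * i + s + 1 : ℕ) : ℝ) ∧
      ∑ s ∈ Finset.range (m * n - m * i), 1 / ((m * i + s + 1 : ℕ) : ℝ) ≤ 2 * Real.log n := by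
  filter_upwards [eventually_ge_atTop i, eventually_gt_atTop 0,
    tendsto_log_natCast.eventually_ge_atTop (2 * (harmonic (m * i) : ℝ)),
    tendsto_log_natCast.eventually_ge_atTop (1 + Real.log m)] with n hn hn0 h1 h2
  rw [sum_shifted_harmonic, Nat.add_sub_cancel' (Nat.mul_le_mul_left m hn)]
  have h3 : Real.log (m * n : ℕ) = Real.log m + Real.log n := by
    rw [Nat.cast_mul, Real.log_mul (by positivity) (by positivity)]
  have h4 := log_le_harmonic (Nat.mul_pos hm hn0)
  have h5 := harmonic_le_one_add_log (m * n)
  have h6 : (0 : ℝ) ≤ harmonic (m * i) := by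
    rcases Nat.eq_zero_or_pos (m * i) with h | h
    · simp [h]
    · exact_mod_cast (harmonic_pos h.ne').le
  have h7 : 0 ≤ Real.log m := Real.log_natCast_nonneg m
  rw [h3] at h4 h5
  constructor <;> linarith

end DePref

/-! ### Choice of constants and conclusion. -/

theorem theorem2p4 (m : ℕ) (hm : 1 < m) (α δ : ℝ) (hα : 0 < α) (hδ : -1 < δ) :
    ∃ c C : ℝ, 0 < c ∧ c < C ∧
      ∀ (Ω : Type*) [MeasurableSpace Ω] (P : Measure Ω) [IsProbabilityMeasure P]
        (e : ℕ → ℕ → Ω → ℕ), DePref.IsInverseDePreferential m α δ P e →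
        ∀ i : ℕ, 1 ≤ i →
          Tendsto
            (fun n : ℕ => P {ω |
              c ≤ (DePref.degree m (fun l r => e l r ω) i n 0 : ℝ) /
                  ((m : ℝ) * Real.log (n : ℝ) ^ (1 / (1 + α))) ∧
              (DePref.degree m (fun l r => e l r ω) i n 0 : ℝ) /
                  ((m : ℝ) * Real.log (n : ℝ) ^ (1 / (1 + α))) ≤ C})
            atTop (𝓝 1) := by
  have hm0 : 0 < m := by omega
  have hm2 : (2 : ℝ) ≤ m := by exact_mod_cast hm
  have hα1 : 0 < 1 + α := by linarith
  have hW : 0 < (δ + 6 * (m : ℝ)) ^ α := Real.rpow_pos_of_pos (by linarith) _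
  set hi : ℝ := 4 * m * (δ + 6 * m) ^ α with hhi
  have hi0 : 0 < hi := by positivity
  set R : ℝ := (1 + α) * 2 ^ α * hi + 1 with hR
  have hR0 : 0 < R := by positivity
  -- Here `1 / 4` is `lo / 2` with `lo = 1`, times the `1 / 2` in the lower bound of the sum by `log
  -- n`; `1 + |δ|` converts `δ + d` into `d`.
  set c : ℝ := (1 / 4) ^ (1 / (1 + α)) / ((1 + |δ|) * m) with hc
  have hc0 : 0 < c := by positivity
  have hC0 : 0 < 2 * (2 * R) ^ (1 / (1 + α)) / m := by positivity
  -- The summand `c` only secures the strict inequality of the constants. The outer `2` comes from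
  -- `d ≤ 2 * (δ + d)`, valid as `d ≥ 2` and `δ > -1`; the inner one from the sum being at most `2 *
  -- log n`.
  refine ⟨c, c + 2 * (2 * R) ^ (1 / (1 + α)) / m, hc0, by linarith, ?_⟩
  intro Ω _ P _ e he i hi1
  have hbirth := (he.isInverseBirthProcess hm hα hδ hi1).tendsto_measure hα one_pos hi0.le
    (fun t => by positivity) (DePref.tendsto_sum_shifted_harmonic (m * i))
  have htime : Tendsto (fun n => m * n - m * i) atTop atTop :=
    (tendsto_sub_atTop_nat (m * i)).comp (tendsto_id.const_mul_atTop' hm0)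
  refine tendsto_of_tendsto_of_tendsto_of_le_of_le' (hbirth.comp htime) tendsto_const_nhds ?_
    (Eventually.of_forall fun n => prob_le_one)
  filter_upwards [DePref.eventually_sum_shifted_harmonic_bounds hm0 i, eventually_ge_atTop i,
    DePref.tendsto_log_natCast.eventually_gt_atTop 0] with n hS hn hL
  refine measure_mono fun ω hω => ?_
  have hadd : m * i + (m * n - m * i) = m * n := Nat.add_sub_cancel' (Nat.mul_le_mul_left m hn)
  simp only [Set.mem_ofPred_eq, hadd, Nat.mul_div_cancel_left n hm0, Nat.mul_mod_right] at hω
  obtain ⟨hω1, hω2⟩ := hω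
  obtain ⟨hd, hy⟩ :=
    DePref.one_le_shift_degree (k := 0) hm hδ (fun l r => e l r ω) hi1 hn
  rw [← hhi, ← hR] at hω2
  set S := ∑ s ∈ Finset.range (m * n - m * i), 1 / ((m * i + s + 1 : ℕ) : ℝ)
  set d : ℝ := (DePref.degree m (fun l r => e l r ω) i n 0 : ℝ)
  set L := Real.log (n : ℝ)
  have hy0 : 0 < δ + d := by linarith
  have hinv : ((δ + d) ^ (1 + α)) ^ (1 / (1 + α)) = δ + d := by
    rw [← Real.rpow_mul hy0.le, mul_one_div_cancel hα1.ne', Real.rpow_one]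
  have hβ : 0 ≤ 1 / (1 + α) := by positivity
  have hlower : (1 / 4) ^ (1 / (1 + α)) * L ^ (1 / (1 + α)) ≤ δ + d := by
    rw [← Real.mul_rpow (by norm_num) hL.le, ← hinv]
    exact Real.rpow_le_rpow (by positivity) (by linarith [hS.1]) hβ
  have hupper : δ + d ≤ (2 * R) ^ (1 / (1 + α)) * L ^ (1 / (1 + α)) := by
    rw [← Real.mul_rpow (by positivity) hL.le, ← hinv]
    exact Real.rpow_le_rpow (by positivity) (by nlinarith [hS.2]) hβ
  have hLβ : 0 < L ^ (1 / (1 + α)) := by positivity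
  have hden : 0 < (m : ℝ) * L ^ (1 / (1 + α)) := by positivity
  constructor
  · have h1 : δ + d ≤ (1 + |δ|) * d := by
      nlinarith [le_abs_self δ, abs_nonneg δ]
    rw [hc, le_div_iff₀ hden, div_mul_eq_mul_div, div_le_iff₀ (by positivity)]
    calc _ = ((1 / 4) ^ (1 / (1 + α)) * L ^ (1 / (1 + α))) * m := by ring
      _ ≤ ((1 + |δ|) * d) * m := mul_le_mul_of_nonneg_right (by linarith) (by positivity)
      _ = _ := by ring
  · refine le_trans ?_ (le_add_of_nonneg_left hc0.le)
    rw [div_le_div_iff₀ hden (by positivity)]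
    have h1 : d ≤ 2 * (δ + d) := by linarith
    calc d * m ≤ (2 * ((2 * R) ^ (1 / (1 + α)) * L ^ (1 / (1 + α)))) * m :=
          mul_le_mul_of_nonneg_right (by linarith) (by positivity)
      _ = _ := by ring
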